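/- Let $F_n$ be the free group on $A_n=\{a_1,\dots,a_n\}$; for $l\ge 1$ let $\mathcal W(l)$ be the set of freely reduced words of length $l$ in $F_n$. Let $k\ge 3$ and put $(p,q)=(\tfrac k3,\tfrac k3)$, $(\tfrac{k-1}3,\tfrac{k+2}3)$ or $(\tfrac{k+1}3,\tfrac{k-2}3)$ according as $k\equiv 0,1,2 \pmod 3$, so $2p+q=k$. Let $\Gamma=\langle A_n\mid R\rangle$ be a finite presentation, with $R$ a finite set of freely reduced words; if $3\mid k$, assume that the relators of length $k$ are cyclically reduced. Let $\Delta_k=\Delta_k(A_n\mid R)$ be the finite graph (multiple edges allowed) with vertex set $\mathcal W(p)\cup\mathcal W(q)$ in which each relator $r\in R$ of length $k$, written as $r=r_xr_yr_z$ without cancellation with $r_x,r_y\in\mathcal W(p)$ and $r_z\in\mathcal W(q)$, contributes the three edges $$\{r_x,r_z^{-1}\},\quad \{r_y,r_x^{-1}\},\quad \{r_z,r_y^{-1}\},$$ edges being counted with multiplicity. Let $A$ be the adjacency matrix of $\Delta_k$, whose entry at $(u,v)$ is the number of edges joining $u$ and $v$, let $D$ be the diagonal matrix of the degrees $\deg(u)=\sum_v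 A_{u,v}$, and assume that every vertex has positive degree, so that the normalized Laplacian $L=I-D^{-1/2}AD^{-1/2}$ is defined. Let $\lambda_0\le\lambda_1\le\cdots$ be the eigenvalues of $L$, with multiplicity. If $\lambda_1(\Delta_k)>\tfrac12$, then $\Gamma$ has Property (T): for every finite generating set $S$ of $\Gamma$, every unitary representation $\pi$ of $\Gamma$ on a Hilbert space such that for every $\varepsilon>0$ there is $u\ne 0$ with $\|\pi(s)u-u\|<\varepsilon\|u\|$ for all $s\in S$ has a non-zero $\Gamma$-invariant vector. -/

import Mathlib

/-! ### Multigraphs and the normalized Laplacian -/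

/-- A graph with vertex set `V`: its edges form a finite multiset of unordered pairs of vertices
(multiple edges are counted, and pairs `{u, u}` are allowed). -/
structure EdgeMultigraph (V : Type*) where
  edges : Multiset (Sym2 V)

namespace EdgeMultigraph

section

variable {V : Type*} [Fintype V] [DecidableEq V] (G : EdgeMultigraph V)

/-- The number of edges joining `u` and `v`. -/
def mult (u v : V) : ℕ := G.edges.count s(u, v)

/-- The degree `deg u = ∑ v, mult u v`. -/
def degree (u : V) : ℕ := ∑ v, G.mult u v

/-- The adjacency matrix `A`. -/
def adjMatrix : Matrix V V ℝ := Matrix.of fun u v => (G.mult u v : ℝ)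

/-- The matrix `D ^ (-1/2)`, where `D` is the diagonal matrix of degrees.  It has this meaning
when all degrees are positive. -/
noncomputable def invSqrtDegMatrix : Matrix V V ℝ :=
  Matrix.diagonal fun u => (Real.sqrt (G.degree u))⁻¹

/-- The normalized Laplacian `L = I - D ^ (-1/2) A D ^ (-1/2)`. -/
noncomputable def normLaplacian : Matrix V V ℝ :=
  1 - G.invSqrtDegMatrix * G.adjMatrix * G.invSqrtDegMatrix

theorem normLaplacian_isHermitian : G.normLaplacian.IsHermitian := by
  ext u v
  have h : G.mult v u = G.mult u v := by
    unfold mult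
    rw [Sym2.eq_swap]
  simp only [normLaplacian, invSqrtDegMatrix, adjMatrix, Matrix.conjTranspose_apply,
    Matrix.sub_apply, Matrix.mul_diagonal, Matrix.diagonal_mul, Matrix.of_apply, star_trivial, h,
    Matrix.one_apply, eq_comm (a := v) (b := u)]
  ring

/-- `G.lam i` is the eigenvalue `λ_i` of the normalized Laplacian, where the eigenvalues are listed
with multiplicity in increasing order `λ_0 ≤ λ_1 ≤ … ≤ λ_{m-1}`, `m = |V|`.
(`Matrix.IsHermitian.eigenvalues₀` lists them in decreasing order, hence `Fin.rev`.)
For `i ≥ m`, where there is no such eigenvalue, the value is `0`. -/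
noncomputable def lam (i : ℕ) : ℝ :=
  if h : i < Fintype.card V then
    G.normLaplacian_isHermitian.eigenvalues₀ (Fin.rev ⟨i, h⟩)
  else 0

end

end EdgeMultigraph

/-! ### The graph `Δ_k(A_n | R)` -/

namespace SplitGraph

/-- The common length of the first two pieces `r_x`, `r_y` of a relator of length `k`. -/
def lenXY (k : ℕ) : ℕ :=
  if k % 3 = 0 then k / 3 else if k % 3 = 1 then (k - 1) / 3 else (k + 1) / 3

/-- The length of the last piece `r_z` of a relator of length `k`. -/
def lenZ (k : ℕ) : ℕ :=
  if k % 3 = 0 then k / 3 else if k % 3 = 1 then (k + 2) / 3 else (k - 2) / 3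

theorem len_add (k : ℕ) : lenXY k + lenXY k + lenZ k = k := by
  unfold lenXY lenZ
  split_ifs <;> omega

/-- The vertex set of `Δ_k`: the elements of the free group `F_n` whose reduced word has length
`lenXY k` or `lenZ k`.  If `3 ∣ k` these two lengths agree, and otherwise they are different, so
that this is the disjoint union of the two sets of reduced words. -/
def Vertex (n k : ℕ) : Type :=
  {w : FreeGroup (Fin n) // w.norm = lenXY k ∨ w.norm = lenZ k}

instance (n k : ℕ) : DecidableEq (Vertex n k) :=
  inferInstanceAs (DecidableEq {w : FreeGroup (Fin n) // w.norm = lenXY k ∨ w.norm = lenZ k})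

instance (n k : ℕ) : Finite (Vertex n k) := by
  have h : Set.Finite {L : List (Fin n × Bool) | L.length ≤ lenXY k + lenZ k} :=
    List.finite_length_le _ _
  have : Finite {L : List (Fin n × Bool) | L.length ≤ lenXY k + lenZ k} := h
  refine Finite.of_injective
    (fun w : Vertex n k =>
      (⟨w.1.toWord, ?_⟩ : {L : List (Fin n × Bool) | L.length ≤ lenXY k + lenZ k})) ?_
  · have h2 := w.2
    simp only [FreeGroup.norm] at h2
    simp only [Set.mem_ofPred_eq]
    omega
  · intro a b hab
    exact Subtype.ext (FreeGroup.toWord_injective (congrArg Subtype.val hab))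

noncomputable instance (n k : ℕ) : Fintype (Vertex n k) := Fintype.ofFinite _

/-- The inverse of a vertex. -/
def Vertex.inv {n k : ℕ} (w : Vertex n k) : Vertex n k :=
  ⟨w.1⁻¹, by rw [FreeGroup.norm_inv_eq]; exact w.2⟩

theorem norm_mk_infix {n : ℕ} (r : FreeGroup (Fin n)) {L : List (Fin n × Bool)}
    (h : L <:+: r.toWord) : (FreeGroup.mk L).norm = L.length := by
  have hL : FreeGroup.IsReduced L := List.IsChain.infix FreeGroup.isReduced_toWord h
  rw [FreeGroup.norm, FreeGroup.toWord_mk, hL.reduce_eq]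

section

variable {n k : ℕ} (r : FreeGroup (Fin n)) (hr : r.norm = k)

/-- The piece `r_x`: the first `lenXY k` letters of the relator `r` of length `k`. -/
def pieceX : Vertex n k :=
  ⟨FreeGroup.mk (r.toWord.take (lenXY k)), Or.inl <| by
    rw [norm_mk_infix r (List.take_prefix _ _).isInfix, List.length_take]
    have h := len_add k
    rw [FreeGroup.norm] at hr
    omega⟩

/-- The piece `r_y`: the next `lenXY k` letters. -/
def pieceY : Vertex n k :=
  ⟨FreeGroup.mk ((r.toWord.drop (lenXY k)).take (lenXY k)), Or.inl <| by
    rw [norm_mk_infix r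
      ((List.take_prefix _ _).isInfix.trans (List.drop_suffix _ _).isInfix),
      List.length_take, List.length_drop]
    have h := len_add k
    rw [FreeGroup.norm] at hr
    omega⟩

/-- The piece `r_z`: the last `lenZ k` letters. -/
def pieceZ : Vertex n k :=
  ⟨FreeGroup.mk (r.toWord.drop (lenXY k + lenXY k)), Or.inr <| by
    rw [norm_mk_infix r (List.drop_suffix _ _).isInfix, List.length_drop]
    have h := len_add k
    rw [FreeGroup.norm] at hr
    omega⟩

theorem pieceX_mul_pieceY_mul_pieceZ :
    (pieceX r hr).1 * (pieceY r hr).1 * (pieceZ r hr).1 = r := by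
  simp only [pieceX, pieceY, pieceZ, FreeGroup.mul_mk]
  rw [← List.drop_drop, List.append_assoc, List.take_append_drop, List.take_append_drop,
    FreeGroup.mk_toWord]

/-- The three edges contributed by a relator `r = r_x r_y r_z` of length `k`. -/
def relatorEdges : Multiset (Sym2 (Vertex n k)) :=
  {s(pieceX r hr, (pieceZ r hr).inv),
   s(pieceY r hr, (pieceX r hr).inv),
   s(pieceZ r hr, (pieceY r hr).inv)}

end

/-- The graph `Δ_k(A_n | R)`: every relator of length `k` contributes its three edges, and edges
are counted with multiplicity. -/
def graph (n k : ℕ) (R : Finset (FreeGroup (Fin n))) : EdgeMultigraph (Vertex n k) where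
  edges := ∑ r ∈ (R.filter fun r => r.norm = k).attach,
    relatorEdges r.1 (Finset.mem_filter.1 r.2).2

end SplitGraph

/-! ### Property (T) -/

universe u v

/-- The unitary representation `π` has almost-invariant vectors with respect to `S`. -/
def HasAlmostInvariantVectors {Γ : Type*} [Group Γ] {H : Type*} [NormedAddCommGroup H]
    [InnerProductSpace ℂ H] (S : Finset Γ) (π : Γ →* (H ≃ₗᵢ[ℂ] H)) : Prop :=
  ∀ ε : ℝ, 0 < ε → ∃ u : H, u ≠ 0 ∧ ∀ s ∈ S, ‖π s u - u‖ < ε * ‖u‖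

/-- Property (T) for a finitely generated discrete group: for every finite generating set and every
complex Hilbert space, each unitary representation with almost-invariant vectors has a non-zero
invariant vector. -/
def HasPropertyT (Γ : Type v) [Group Γ] : Prop :=
  Group.FG Γ ∧
    ∀ S : Finset Γ, Subgroup.closure (S : Set Γ) = ⊤ →
      ∀ (H : Type u) [NormedAddCommGroup H] [InnerProductSpace ℂ H] [CompleteSpace H]
        (π : Γ →* (H ≃ₗᵢ[ℂ] H)),
        HasAlmostInvariantVectors S π → ∃ u : H, u ≠ 0 ∧ ∀ g : Γ, π g u = u

/-! This is a spectral criterion for Property (T), proved by a Poincaré inequality. Let `ρ` be a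
unitary representation of the free group that kills `R`, and apply the inequality on `Δ_k` to `f u =
ρ u x - x`. If `r_x r_y r_z` acts trivially, the edge `{r_x, r_z⁻¹}` has `‖f r_x - f r_z⁻¹‖ = ‖f
r_y‖`, and cyclically for the other two edges. The Dirichlet energy, summed over ordered pairs,
therefore equals the degree-weighted sum `S` of the `‖f u‖ ^ 2` (`sum_mult_mul_norm_sub_sq_eq`).

Let `D` be the group Laplacian weighted by degrees and `vol` the sum of the degrees. Then `∑ deg u •
f u = -D x` and `Re ⟪D x, x⟫ = S / 2`, so the Poincaré inequality reads `(λ₁ - 1/2) S ≤ λ₁ ‖D x‖ ^ 2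
/ vol`. For `λ₁ > 1/2` this is a uniform bound `c ⟪D x, x⟫ ≤ ‖D x‖ ^ 2`: the positive operator `D`
has a gap above `0`.

An almost-invariant vector is thus close to `ker D`, whose elements are fixed by the subgroup
generated by the vertices. That subgroup has finite index, and summing translates over its cosets
gives a vector fixed by the whole group. The sum is non-zero because every translate stays close to
the original almost-invariant vector. -/

/-! ### Spectral decomposition of real symmetric matrices acting on vector-valued functions. -/

namespace Matrix.IsHermitian

open Matrix

variable {V : Type*} [Fintype V] [DecidableEq V] {L : Matrix V V ℝ} (hL : L.IsHermitian)

theorem sum_eigenvectorBasis_mul (u v : V) :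
    ∑ i, hL.eigenvectorBasis i u * hL.eigenvectorBasis i v = if u = v then 1 else 0 := by
  have h := hL.eigenvectorBasis.sum_inner_mul_inner (EuclideanSpace.single u (1 : ℝ))
    (EuclideanSpace.single v (1 : ℝ))
  simpa [EuclideanSpace.inner_single_left, EuclideanSpace.inner_single_right,
    PiLp.single_apply, eq_comm (a := u) (b := v)] using h

theorem sum_mul_eigenvectorBasis (u i : V) :
    ∑ v, L u v * hL.eigenvectorBasis i v = hL.eigenvalues i * hL.eigenvectorBasis i u := by
  simpa [Matrix.mulVec, dotProduct] using congrFun (hL.mulVec_eigenvectorBasis i) u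

theorem apply_eq_sum_eigenvalues (u v : V) :
    L u v = ∑ i, hL.eigenvalues i * (hL.eigenvectorBasis i u * hL.eigenvectorBasis i v) := by
  calc L u v = ∑ w, L u w * ∑ i, hL.eigenvectorBasis i w * hL.eigenvectorBasis i v := by
        simp [sum_eigenvectorBasis_mul]
    _ = ∑ i, (∑ w, L u w * hL.eigenvectorBasis i w) * hL.eigenvectorBasis i v := by
        simp only [Finset.mul_sum, Finset.sum_mul]
        rw [Finset.sum_comm]
        simp only [mul_assoc]
    _ = _ := by simp only [sum_mul_eigenvectorBasis, mul_assoc]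

variable {E : Type*} [NormedAddCommGroup E] [InnerProductSpace ℝ E]

theorem sum_mul_inner_eq {V : Type*} [Fintype V] (c : V → ℝ) (b : V → V → ℝ) (g : V → E) :
    ∑ u, ∑ v, (∑ i, c i * (b i u * b i v)) * inner ℝ (g u) (g v) =
      ∑ i, c i * ‖∑ u, b i u • g u‖ ^ 2 := by
  simp only [← real_inner_self_eq_norm_sq, sum_inner, inner_sum, real_inner_smul_left,
    real_inner_smul_right, Finset.sum_mul, Finset.mul_sum]
  rw [Finset.sum_comm_cycle]
  refine Finset.sum_congr rfl fun i _ => ?_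
  rw [Finset.sum_comm]
  refine Finset.sum_congr rfl fun u _ => Finset.sum_congr rfl fun v _ => ?_
  rw [real_inner_comm (g u) (g v)]
  ring

/-- If `e` spans the kernel direction of a symmetric matrix all of whose eigenvalues but one are
at least `c > 0`, then the matrix is bounded below by `c` on the orthogonal complement of `e`. -/
theorem mul_sum_norm_sq_sub_le {e : V → ℝ} (he : ∀ u, ∑ v, L u v * e v = 0)
    (he0 : 0 < ∑ u, e u ^ 2) {c : ℝ} (hc : 0 < c) {i₀ : V}
    (hi : ∀ i, i ≠ i₀ → c ≤ hL.eigenvalues i) (g : V → E) :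
    c * (∑ u, ‖g u‖ ^ 2 - ‖∑ u, e u • g u‖ ^ 2 / ∑ u, e u ^ 2) ≤
      ∑ u, ∑ v, L u v * inner ℝ (g u) (g v) := by
  set b : V → V → ℝ := fun i u => hL.eigenvectorBasis i u with hb
  set G : V → E := fun i => ∑ u, b i u • g u with hG
  set a : V → ℝ := fun i => ∑ u, e u * b i u with ha
  have hsum : ∀ u v, ∑ i, b i u * b i v = if u = v then 1 else 0 :=
    hL.sum_eigenvectorBasis_mul
  have hLe : ∑ u, ∑ v, L u v * inner ℝ (g u) (g v) = ∑ i, hL.eigenvalues i * ‖G i‖ ^ 2 := by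
    rw [← sum_mul_inner_eq]
    refine Finset.sum_congr rfl fun u _ => Finset.sum_congr rfl fun v _ => ?_
    rw [hL.apply_eq_sum_eigenvalues u v]
  have hg : ∑ u, ‖g u‖ ^ 2 = ∑ i, ‖G i‖ ^ 2 := by
    have := sum_mul_inner_eq (fun _ => 1) b g
    simp only [one_mul, hsum] at this
    simpa using this
  -- Pairing `L e = 0` with the eigenvector `b i` and moving `L` across by symmetry.
  have hea : ∀ i, hL.eigenvalues i * a i = 0 := by
    intro i
    have h1 : ∑ u, (∑ v, L u v * e v) * b i u = 0 := by simp [he]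
    rw [← h1]
    simp only [ha, Finset.mul_sum, Finset.sum_mul]
    rw [Finset.sum_comm]
    refine Finset.sum_congr rfl fun v _ => ?_
    have h2 := hL.sum_mul_eigenvectorBasis v i
    calc hL.eigenvalues i * (e v * b i v) = e v * (hL.eigenvalues i * b i v) := by ring
      _ = e v * ∑ u, L v u * b i u := by rw [h2]
      _ = _ := by
        rw [Finset.mul_sum]
        refine Finset.sum_congr rfl fun u _ => ?_
        have h3 : L u v = L v u := by simpa using hL.apply v u
        rw [h3]
        ring
  -- Positive eigenvalues force orthogonality to `e`, so `e` is a multiple of `b i₀` alone and the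
  -- eigenvalue at `i₀` must be `0`.
  have ha0 : ∀ i, i ≠ i₀ → a i = 0 := fun i h =>
    (mul_eq_zero.1 (hea i)).resolve_left (hc.trans_le (hi i h)).ne'
  have hexp : ∀ v, e v = a i₀ * b i₀ v := by
    intro v
    calc e v = ∑ u, e u * ∑ i, b i u * b i v := by simp [hsum]
      _ = ∑ i, a i * b i v := by
        simp only [ha, Finset.mul_sum, Finset.sum_mul]
        rw [Finset.sum_comm]
        simp only [mul_assoc]
      _ = _ := Finset.sum_eq_single i₀ (fun i _ h => by rw [ha0 i h, zero_mul]) (by simp)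
  have hee : ∑ u, e u ^ 2 = a i₀ ^ 2 := by
    calc ∑ u, e u ^ 2 = ∑ u, a i₀ * (e u * b i₀ u) := by
          refine Finset.sum_congr rfl fun u _ => ?_
          have := hexp u
          rw [sq]
          nth_rewrite 2 [this]
          ring
      _ = _ := by rw [← Finset.mul_sum, sq]
  have hGe : ∑ u, e u • g u = a i₀ • G i₀ := by
    simp only [hG, Finset.smul_sum, smul_smul, ← hexp]
  have ha1 : a i₀ ≠ 0 := by
    intro h
    rw [hee, h] at he0
    simp at he0
  have hev : hL.eigenvalues i₀ = 0 := (mul_eq_zero.1 (hea i₀)).resolve_right ha1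
  rw [hLe, hg, hGe, hee, norm_smul, mul_pow, Real.norm_eq_abs, sq_abs,
    mul_div_cancel_left₀ _ (pow_ne_zero 2 ha1), ← Finset.add_sum_erase _ _ (Finset.mem_univ i₀),
    ← Finset.add_sum_erase _ (fun i => hL.eigenvalues i * ‖G i‖ ^ 2) (Finset.mem_univ i₀), hev,
    add_sub_cancel_left, zero_mul, zero_add, Finset.mul_sum]
  refine Finset.sum_le_sum fun i h => ?_
  exact mul_le_mul_of_nonneg_right (hi i (Finset.ne_of_mem_erase h)) (sq_nonneg _)

end Matrix.IsHermitian

/-! ### The Poincaré inequality on a multigraph. -/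

namespace EdgeMultigraph

variable {V : Type*} [Fintype V] [DecidableEq V] (G : EdgeMultigraph V)

theorem mult_comm {V : Type*} [DecidableEq V] (G : EdgeMultigraph V) (u v : V) : G.mult u v = G.mult v u := by
  rw [mult, mult, Sym2.eq_swap]

/-- The exceptional index is the one carrying `λ₀`. Positivity of `lam 1` rules out its default
value `0`, so there are at least two vertices. -/
theorem exists_forall_lam_one_le (h : 0 < G.lam 1) :
    ∃ i₀, ∀ i, i ≠ i₀ → G.lam 1 ≤ G.normLaplacian_isHermitian.eigenvalues i := by
  unfold lam at h ⊢
  split_ifs at h ⊢ with hc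
  · set φ : Fin (Fintype.card V) ≃ V := Fintype.equivOfCardEq (Fintype.card_fin _) with hφ
    refine ⟨φ (Fin.rev ⟨0, by omega⟩), fun i hi => ?_⟩
    refine G.normLaplacian_isHermitian.eigenvalues₀_antitone ?_
    have h1 : φ.symm i ≠ Fin.rev ⟨0, by omega⟩ := fun h => hi (by rw [← h, φ.apply_symm_apply])
    have h2 := (φ.symm i).2
    change φ.symm i ≤ _
    rw [Fin.le_def, Fin.val_rev]
    -- `eigenvalues₀` is decreasing, so `λ₀` sits at position `card V - 1` and `λ₁` at `card V - 2`;
    -- any position other than the last is at most the latter.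
    have h3 : (φ.symm i : ℕ) ≠ Fintype.card V - 1 := fun h =>
      h1 (Fin.ext (by rw [Fin.val_rev]; simpa using h))
    simp only
    omega
  · exact absurd h (lt_irrefl _)

theorem normLaplacian_apply (u v : V) :
    G.normLaplacian u v = (if u = v then 1 else 0) -
      (√(G.degree u))⁻¹ * G.mult u v * (√(G.degree v))⁻¹ := by
  simp [normLaplacian, invSqrtDegMatrix, adjMatrix, Matrix.mul_diagonal, Matrix.diagonal_mul,
    Matrix.one_apply]

variable {E : Type*} [NormedAddCommGroup E] [InnerProductSpace ℝ E]

theorem sum_mult_mul_norm_sub_sq (f : V → E) :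
    ∑ u, ∑ v, (G.mult u v : ℝ) * ‖f u - f v‖ ^ 2 =
      2 * (∑ u, (G.degree u : ℝ) * ‖f u‖ ^ 2 -
        ∑ u, ∑ v, (G.mult u v : ℝ) * inner ℝ (f u) (f v)) := by
  have h1 : ∑ u, ∑ v, (G.mult u v : ℝ) * ‖f u‖ ^ 2 = ∑ u, (G.degree u : ℝ) * ‖f u‖ ^ 2 := by
    simp only [degree, Nat.cast_sum, Finset.sum_mul]
  have h2 : ∑ u, ∑ v, (G.mult u v : ℝ) * ‖f v‖ ^ 2 = ∑ u, (G.degree u : ℝ) * ‖f u‖ ^ 2 := by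
    rw [Finset.sum_comm, ← h1]
    simp only [G.mult_comm]
  have h3 : ∑ u, ∑ v, (G.mult u v : ℝ) * ‖f u - f v‖ ^ 2 =
      ∑ u, ∑ v, (G.mult u v : ℝ) * ‖f u‖ ^ 2 + ∑ u, ∑ v, (G.mult u v : ℝ) * ‖f v‖ ^ 2 -
        2 * ∑ u, ∑ v, (G.mult u v : ℝ) * inner ℝ (f u) (f v) := by
    simp only [Finset.mul_sum, ← Finset.sum_add_distrib, ← Finset.sum_sub_distrib]
    refine Finset.sum_congr rfl fun u _ => Finset.sum_congr rfl fun v _ => ?_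
    rw [norm_sub_sq_real]
    ring
  rw [h3, h1, h2]
  ring

/-- The Poincaré inequality for maps from a multigraph to a Hilbert space. -/
theorem lam_one_mul_le (hdeg : ∀ v, 0 < G.degree v) (h : 0 < G.lam 1) (f : V → E) :
    G.lam 1 * (∑ u, (G.degree u : ℝ) * ‖f u‖ ^ 2 -
        ‖∑ u, G.degree u • f u‖ ^ 2 / ∑ u, (G.degree u : ℝ)) ≤
      1 / 2 * ∑ u, ∑ v, (G.mult u v : ℝ) * ‖f u - f v‖ ^ 2 := by
  obtain ⟨i₀, hi₀⟩ := G.exists_forall_lam_one_le h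
  have hpos : ∀ u, (0 : ℝ) < G.degree u := fun u => by exact_mod_cast hdeg u
  have hsq : ∀ u, √(G.degree u : ℝ) ^ 2 = G.degree u := fun u => Real.sq_sqrt (hpos u).le
  have hne : ∀ u, √(G.degree u : ℝ) ≠ 0 := fun u => (Real.sqrt_pos.2 (hpos u)).ne'
  -- The square roots of the degrees span the kernel direction of the normalized Laplacian;
  -- substituting `√deg • f` below turns its quadratic form into the Dirichlet energy.
  have he : ∀ u, ∑ v, G.normLaplacian u v * √(G.degree v) = 0 := by
    intro u
    simp only [normLaplacian_apply, sub_mul, Finset.sum_sub_distrib, mul_assoc,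
      inv_mul_cancel₀ (hne _), mul_one, ← Finset.mul_sum]
    rw [← Nat.cast_sum, ← degree]
    have := hsq u
    simp only [ite_mul, one_mul, zero_mul, Finset.sum_ite_eq, Finset.mem_univ, if_true]
    nth_rewrite 3 [← this]
    field_simp [hne u]
    simp
  have he0 : 0 < ∑ u, √(G.degree u : ℝ) ^ 2 :=
    Finset.sum_pos (fun u _ => by rw [hsq]; exact hpos u) ⟨i₀, Finset.mem_univ _⟩
  have key := G.normLaplacian_isHermitian.mul_sum_norm_sq_sub_le he he0 h hi₀
    (fun u => √(G.degree u : ℝ) • f u)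
  have h1 : ∀ u, √(G.degree u : ℝ) • √(G.degree u : ℝ) • f u = G.degree u • f u := by
    intro u
    rw [smul_smul, ← sq, hsq, Nat.cast_smul_eq_nsmul]
  simp only [h1, hsq, norm_smul, mul_pow, Real.norm_eq_abs, sq_abs] at key
  refine key.trans (le_of_eq ?_)
  rw [sum_mult_mul_norm_sub_sq, ← mul_assoc, one_div_mul_cancel two_ne_zero, one_mul]
  simp only [normLaplacian_apply, sub_mul, Finset.sum_sub_distrib, real_inner_smul_left,
    real_inner_smul_right]
  congr 1
  · refine Finset.sum_congr rfl fun u _ => ?_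
    simp only [ite_mul, one_mul, zero_mul, Finset.sum_ite_eq, Finset.mem_univ, if_true,
      real_inner_self_eq_norm_sq]
    rw [← mul_assoc, ← sq, hsq]
  · refine Finset.sum_congr rfl fun u _ => Finset.sum_congr rfl fun v _ => ?_
    have := hne u
    have := hne v
    field_simp

end EdgeMultigraph

/-! ### Spectral gap of a positive operator. -/

section SpectralGap

variable {H : Type*} [NormedAddCommGroup H] [InnerProductSpace ℂ H]

open ContinuousLinearMap in
/-- A positive operator satisfying `c ⟪D x, x⟫ ≤ ‖D x‖ ^ 2` has no spectrum in `(0, c)`. -/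
theorem ContinuousLinearMap.exists_apply_eq_zero_mul_norm_sub_sq_le [CompleteSpace H]
    (D : H →L[ℂ] H) (hsym : ∀ x y, inner ℂ (D x) y = inner ℂ x (D y))
    (hpos : ∀ x, 0 ≤ (inner ℂ (D x) x).re) {c : ℝ} (hc : 0 < c)
    (hgap : ∀ x, c * (inner ℂ (D x) x).re ≤ ‖D x‖ ^ 2) (u : H) :
    ∃ v, D v = 0 ∧ c * ‖u - v‖ ^ 2 ≤ (inner ℂ (D u) u).re := by
  -- On the range of `D` the gap needs no functional calculus: positivity of `D` at `w - c⁻¹ D w`,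
  -- expanded and combined with `hgap` at `w`, suffices.
  have hrange : ∀ w, c * ‖D w‖ ^ 2 ≤ (inner ℂ (D (D w)) (D w)).re := by
    intro w
    have h := hpos (w - ((c⁻¹ : ℝ) : ℂ) • D w)
    have h2 : (inner ℂ (D w) (D w)).re = ‖D w‖ ^ 2 := by
      rw [inner_self_eq_norm_sq_to_K]; norm_cast
    have h3 : (inner ℂ (D (D w)) w).re = ‖D w‖ ^ 2 := by rw [hsym, h2]
    simp only [map_sub, map_smul, inner_sub_left, inner_sub_right, inner_smul_left,
      inner_smul_right, Complex.sub_re, Complex.conj_ofReal, Complex.re_ofReal_mul, h2, h3] at h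
    have h4 := hgap w
    have h5 : 0 ≤ c ^ 2 * ((inner ℂ (D w) w).re - c⁻¹ * ‖D w‖ ^ 2 -
        (c⁻¹ * ‖D w‖ ^ 2 - c⁻¹ * (c⁻¹ * (inner ℂ (D (D w)) (D w)).re))) := by
      refine mul_nonneg (sq_nonneg c) ?_
      linarith
    have h6 : c ^ 2 * ((inner ℂ (D w) w).re - c⁻¹ * ‖D w‖ ^ 2 -
        (c⁻¹ * ‖D w‖ ^ 2 - c⁻¹ * (c⁻¹ * (inner ℂ (D (D w)) (D w)).re))) =
        c * (c * (inner ℂ (D w) w).re) - 2 * (c * ‖D w‖ ^ 2) +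
          (inner ℂ (D (D w)) (D w)).re := by
      field_simp
      ring
    nlinarith
  have hadj : ContinuousLinearMap.adjoint D = D :=
    ((ContinuousLinearMap.eq_adjoint_iff D D).2 hsym).symm
  -- For self-adjoint `D` the orthogonal complement of the kernel is the closure of the range, and
  -- the inequality is a closed condition.
  have hclosure : ∀ x ∈ D.kerᗮ, c * ‖x‖ ^ 2 ≤ (inner ℂ (D x) x).re := by
    intro x hx
    rw [D.orthogonal_ker, hadj] at hx
    have hx' : x ∈ closure (D.range : Set H) := by
      rw [← Submodule.topologicalClosure_coe]; exact hx
    have hcl : IsClosed {x : H | c * ‖x‖ ^ 2 ≤ (inner ℂ (D x) x).re} :=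
      isClosed_le (by fun_prop) (Complex.continuous_re.comp (by fun_prop))
    refine closure_minimal ?_ hcl hx'
    rintro _ ⟨w, rfl⟩
    exact hrange w
  have : CompleteSpace D.ker := D.isClosed_ker.completeSpace_coe
  obtain ⟨v, hv, z, hz, rfl⟩ := D.ker.exists_add_mem_mem_orthogonal u
  have hv0 : D v = 0 := hv
  refine ⟨v, hv0, ?_⟩
  have h0 : inner ℂ (D z) v = 0 := by rw [hsym, hv0, inner_zero_right]
  rw [add_sub_cancel_left, map_add, hv0, zero_add, inner_add_right, h0, zero_add]
  exact hclosure z hz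

/-! ### The group Laplacian and invariant vectors. -/

variable {F : Type*} [Group F] (ρ : F →* (H ≃ₗᵢ[ℂ] H)) {V : Type*} [Fintype V]

/-- The group Laplacian `u ↦ ∑ v, d v • (u - ρ (w v) u)` of a weighted family of group elements. -/
noncomputable def groupLaplacian (d : V → ℕ) (w : V → F) : H →L[ℂ] H :=
  ∑ v, d v • (ContinuousLinearMap.id ℂ H -
    ((ρ (w v)).toContinuousLinearEquiv : H →L[ℂ] H))

variable (d : V → ℕ) (w : V → F)

theorem groupLaplacian_apply (u : H) :
    groupLaplacian ρ d w u = ∑ v, d v • (u - ρ (w v) u) := by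
  simp [groupLaplacian]

theorem unitary_mul_apply (g h : F) (u : H) : ρ (g * h) u = ρ g (ρ h u) := by
  rw [map_mul]; rfl

theorem unitary_one_apply (u : H) : ρ 1 u = u := by
  rw [map_one]; rfl

theorem unitary_inv_apply_self (g : F) (u : H) : ρ g⁻¹ (ρ g u) = u := by
  rw [← unitary_mul_apply, inv_mul_cancel, unitary_one_apply]

theorem inner_unitary_apply_left (g : F) (x y : H) :
    inner ℂ (ρ g x) y = inner ℂ x (ρ g⁻¹ y) := by
  rw [← (ρ g⁻¹).inner_map_map, unitary_inv_apply_self]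

theorem norm_unitary_apply_sub_unitary_apply (g h : F) (u : H) :
    ‖ρ g u - ρ h u‖ = ‖ρ (h⁻¹ * g) u - u‖ := by
  rw [← (ρ h⁻¹).norm_map (ρ g u - ρ h u), map_sub, unitary_inv_apply_self, unitary_mul_apply]

theorem norm_unitary_inv_apply_sub (g : F) (u : H) : ‖ρ g⁻¹ u - u‖ = ‖ρ g u - u‖ := by
  rw [norm_sub_rev]
  nth_rewrite 1 [← unitary_one_apply ρ u]
  rw [norm_unitary_apply_sub_unitary_apply, inv_inv, mul_one]

theorem groupLaplacian_symm {inv : V → V} (hinv : Function.Involutive inv)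
    (hw : ∀ v, w (inv v) = (w v)⁻¹) (hd : ∀ v, d (inv v) = d v) (x y : H) :
    inner ℂ (groupLaplacian ρ d w x) y = inner ℂ x (groupLaplacian ρ d w y) := by
  simp only [groupLaplacian_apply, sum_inner, inner_sum, ← Nat.cast_smul_eq_nsmul ℂ,
    inner_smul_left, inner_smul_right, inner_sub_left, inner_sub_right, mul_sub,
    Finset.sum_sub_distrib, Complex.conj_natCast]
  congr 1
  refine Fintype.sum_equiv hinv.toPerm _ _ fun v => ?_
  rw [Function.Involutive.coe_toPerm, hd, hw, inner_unitary_apply_left]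

theorem re_inner_groupLaplacian (u : H) :
    (inner ℂ (groupLaplacian ρ d w u) u).re =
      1 / 2 * ∑ v, (d v : ℝ) * ‖ρ (w v) u - u‖ ^ 2 := by
  simp only [groupLaplacian_apply, sum_inner, ← Nat.cast_smul_eq_nsmul ℂ, inner_smul_left,
    Complex.conj_natCast, Complex.re_sum, Finset.mul_sum]
  refine Finset.sum_congr rfl fun v _ => ?_
  have h1 := @norm_sub_sq ℂ H _ _ _ (ρ (w v) u) u
  rw [(ρ (w v)).norm_map] at h1
  have h2 : (inner ℂ u u).re = ‖u‖ ^ 2 := by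
    rw [inner_self_eq_norm_sq_to_K]; norm_cast
  rw [h1, inner_sub_left, ← Complex.ofReal_natCast, Complex.re_ofReal_mul, Complex.sub_re, h2]
  simp only [RCLike.re_to_complex]
  ring

/-- `Re ⟪D u, u⟫` is a sum of squared displacements with strictly positive weights, so each one
vanishes when `D u = 0`. -/
theorem unitary_apply_eq_of_groupLaplacian_eq_zero (hd : ∀ v, 0 < d v) {u : H}
    (hu : groupLaplacian ρ d w u = 0) (v : V) : ρ (w v) u = u := by
  have h := re_inner_groupLaplacian ρ d w u
  rw [hu, inner_zero_left, Complex.zero_re] at h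
  have h0 : ∑ v, (d v : ℝ) * ‖ρ (w v) u - u‖ ^ 2 = 0 := by linarith
  have h1 := (Finset.sum_eq_zero_iff_of_nonneg fun v _ => by positivity).1 h0 v
    (Finset.mem_univ v)
  have h2 : (d v : ℝ) ≠ 0 := by exact_mod_cast (hd v).ne'
  have h3 := (mul_eq_zero.1 h1).resolve_left h2
  exact sub_eq_zero.1 (norm_eq_zero.1 (pow_eq_zero_iff two_ne_zero |>.1 h3))

/-- Displacement of a vector by a product of generators is controlled by the displacement by the
generators. -/
theorem exists_norm_unitary_apply_sub_le (S : Set F) {g : F} (hg : g ∈ Subgroup.closure S) :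
    ∃ C : ℝ, 0 ≤ C ∧ ∀ (u : H) (ε : ℝ), (∀ s ∈ S, ‖ρ s u - u‖ ≤ ε) → 0 ≤ ε →
      ‖ρ g u - u‖ ≤ C * ε := by
  induction hg using Subgroup.closure_induction with
  | mem x hx => exact ⟨1, zero_le_one, fun u ε h _ => by rw [one_mul]; exact h x hx⟩
  | one => exact ⟨0, le_rfl, fun u ε _ _ => by rw [unitary_one_apply]; simp⟩
  | mul x y _ _ hx hy =>
    obtain ⟨C, hC, h⟩ := hx
    obtain ⟨C', hC', h'⟩ := hy
    refine ⟨C + C', add_nonneg hC hC', fun u ε hu hε => ?_⟩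
    have h1 : ρ (x * y) u - u = ρ x (ρ y u - u) + (ρ x u - u) := by
      rw [unitary_mul_apply, map_sub]; abel
    rw [h1, add_mul, add_comm (C * ε)]
    refine (norm_add_le _ _).trans (add_le_add ?_ (h u ε hu hε))
    rw [(ρ x).norm_map]
    exact h' u ε hu hε
  | inv x _ hx =>
    obtain ⟨C, hC, h⟩ := hx
    exact ⟨C, hC, fun u ε hu hε => by rw [norm_unitary_inv_apply_sub]; exact h u ε hu hε⟩

/-- A vector invariant under a finite-index subgroup, all of whose translates are close to a fixed
nonzero vector, produces a nonzero vector invariant under the whole group. -/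
theorem exists_invariant_of_finiteIndex (Λ : Subgroup F) [Λ.FiniteIndex] {u v : H} (hu : u ≠ 0)
    (hv : ∀ g ∈ Λ, ρ g v = v) (huv : ∀ g : F, ‖ρ g v - u‖ ≤ 1 / 2 * ‖u‖) :
    ∃ x : H, x ≠ 0 ∧ ∀ g, ρ g x = x := by
  have := Λ.fintypeQuotientOfFiniteIndex
  -- Invariance of `v` under `Λ` makes `g ↦ ρ g v` constant on left cosets.
  let ψ : F ⧸ Λ → H := fun q => Quotient.liftOn' q (fun g => ρ g v) fun a b hab => by
    have h := hv _ (QuotientGroup.leftRel_apply.1 hab)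
    change ρ a v = ρ b v
    nth_rewrite 1 [← h]
    rw [← unitary_mul_apply, mul_inv_cancel_left]
  have hψ : ∀ g (q : F ⧸ Λ), ρ g (ψ q) = ψ (g • q) := by
    intro g q
    induction q using QuotientGroup.induction_on with
    | H h => exact (unitary_mul_apply ρ g h v).symm
  refine ⟨∑ q, ψ q, fun h0 => ?_, fun g => ?_⟩
  -- With `m` cosets, a vanishing sum would give `m ‖u‖ ≤ m ‖u‖ / 2`.
  · have h1 : ‖∑ q : F ⧸ Λ, (ψ q - u)‖ ≤ ∑ q : F ⧸ Λ, 1 / 2 * ‖u‖ := by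
      refine norm_sum_le_of_le _ fun q _ => ?_
      induction q using QuotientGroup.induction_on with
      | H h => exact huv h
    rw [Finset.sum_sub_distrib, h0, zero_sub, norm_neg, Finset.sum_const, Finset.sum_const,
      ← Nat.cast_smul_eq_nsmul ℝ, norm_smul, Real.norm_natCast, nsmul_eq_mul] at h1
    have h2 : (0 : ℝ) < (Finset.univ : Finset (F ⧸ Λ)).card := by
      exact_mod_cast Finset.card_pos.2 ⟨_, Finset.mem_univ ((1 : F) : F ⧸ Λ)⟩
    have h3 : 0 < ‖u‖ := norm_pos_iff.2 hu
    have h4 := mul_pos h2 h3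
    linarith
  · rw [map_sum]
    simp only [hψ]
    exact Fintype.sum_equiv (MulAction.toPerm g) _ _ fun q => rfl

end SpectralGap

/-! ### Edges and degrees of `Δ_k`. -/

namespace SplitGraph

variable {n k : ℕ}

theorem lenXY_pos (hk : 3 ≤ k) : 0 < lenXY k := by
  unfold lenXY; split_ifs <;> omega

/-- The element of the free group underlying a vertex. -/
def Vertex.word (v : Vertex n k) : FreeGroup (Fin n) := v.1

theorem Vertex.inv_involutive : Function.Involutive (Vertex.inv : Vertex n k → Vertex n k) :=
  fun v => Subtype.ext (inv_inv v.1)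

theorem pieceX_mul_pieceY_ne_one (hk : 3 ≤ k) (r : FreeGroup (Fin n)) (hr : r.norm = k) :
    (pieceX r hr).1 * (pieceY r hr).1 ≠ 1 := by
  intro h
  have hxy : (pieceX r hr).1 * (pieceY r hr).1 =
      FreeGroup.mk (r.toWord.take (lenXY k + lenXY k)) := by
    simp only [pieceX, pieceY, FreeGroup.mul_mk]
    rw [List.take_add]
  have h1 := norm_mk_infix r (List.take_prefix (lenXY k + lenXY k) _).isInfix
  rw [← hxy, h, FreeGroup.norm_one, List.length_take] at h1
  have h2 := lenXY_pos hk
  rw [FreeGroup.norm] at hr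
  omega

theorem pieceY_mul_pieceZ_ne_one (hk : 3 ≤ k) (r : FreeGroup (Fin n)) (hr : r.norm = k) :
    (pieceY r hr).1 * (pieceZ r hr).1 ≠ 1 := by
  intro h
  have hyz : (pieceY r hr).1 * (pieceZ r hr).1 = FreeGroup.mk (r.toWord.drop (lenXY k)) := by
    simp only [pieceY, pieceZ, FreeGroup.mul_mk]
    rw [← List.drop_drop, List.take_append_drop]
  have h1 := norm_mk_infix r (List.drop_suffix (lenXY k) _).isInfix
  rw [← hyz, h, FreeGroup.norm_one, List.length_drop] at h1
  have h2 := lenXY_pos hk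
  have h3 := len_add k
  rw [FreeGroup.norm] at hr
  omega

/-- This excludes a loop at `r_x = r_z⁻¹`. If `3 ∤ k`, the two pieces have different lengths. If `3
∣ k`, `r_z r_x` is a subword of `r r`, which is reduced because `r` is cyclically reduced. -/
theorem pieceZ_mul_pieceX_ne_one (hk : 3 ≤ k) (r : FreeGroup (Fin n)) (hr : r.norm = k)
    (hcyc : 3 ∣ k → FreeGroup.IsCyclicallyReduced r.toWord) :
    (pieceZ r hr).1 * (pieceX r hr).1 ≠ 1 := by
  intro h
  have h2 := lenXY_pos hk
  have h3 := len_add k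
  have hlen : r.toWord.length = k := hr
  by_cases h3k : 3 ∣ k
  · set L := r.toWord with hL
    have hLL : FreeGroup.IsReduced (L ++ L) := by
      simpa [List.replicate_succ] using ((hcyc h3k).flatten_replicate 2).isReduced
    have hinf : L.drop (lenXY k + lenXY k) ++ L.take (lenXY k) <:+: L ++ L := by
      refine ⟨L.take (lenXY k + lenXY k), L.drop (lenXY k), ?_⟩
      rw [← List.append_assoc, List.take_append_drop, List.append_assoc, List.take_append_drop]
    have hred : FreeGroup.IsReduced (L.drop (lenXY k + lenXY k) ++ L.take (lenXY k)) :=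
      List.IsChain.infix hLL hinf
    have hzx : (pieceZ r hr).1 * (pieceX r hr).1 =
        FreeGroup.mk (L.drop (lenXY k + lenXY k) ++ L.take (lenXY k)) := by
      simp only [pieceX, pieceZ, FreeGroup.mul_mk, hL]
    have h4 := congrArg FreeGroup.toWord (hzx.symm.trans h)
    rw [FreeGroup.toWord_mk, hred.reduce_eq, FreeGroup.toWord_one] at h4
    have h5 := congrArg List.length h4
    rw [List.length_append, List.length_take, List.length_nil] at h5
    omega
  · have h4 : (pieceX r hr).1 = (pieceZ r hr).1⁻¹ := eq_inv_of_mul_eq_one_right h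
    have h5 := congrArg FreeGroup.norm h4
    rw [FreeGroup.norm_inv_eq] at h5
    simp only [pieceX, pieceZ] at h5
    rw [norm_mk_infix r (List.take_prefix _ _).isInfix,
      norm_mk_infix r (List.drop_suffix _ _).isInfix, List.length_take, List.length_drop] at h5
    have h6 : lenXY k ≠ lenZ k := by
      unfold lenXY lenZ; split_ifs <;> omega
    omega

/-- The condition `a ≠ b` matters: a loop would contribute `f a a` once instead of twice. -/
theorem sum_ite_mk_eq {V : Type*} [Fintype V] [DecidableEq V] {a b : V} (hab : a ≠ b)
    (f : V → V → ℝ) :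
    ∑ u, ∑ v, (if s(u, v) = s(a, b) then 1 else 0) * f u v = f a b + f b a := by
  have h : ∀ u v, ((if s(u, v) = s(a, b) then 1 else 0) * f u v : ℝ) =
      (if u = a then if v = b then f u v else 0 else 0) +
        (if u = b then if v = a then f u v else 0 else 0) := by
    intro u v
    simp only [Sym2.eq_iff]
    by_cases h1 : u = a <;> by_cases h2 : v = b <;> by_cases h3 : u = b <;> by_cases h4 : v = a <;>
      simp_all
  simp only [h, Finset.sum_add_distrib]
  simp

variable (R : Finset (FreeGroup (Fin n)))

/-- Rewrites sums over the graph as sums over relators. None of the three edges is a loop, so each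
is met in exactly two orientations. -/
theorem sum_mult_mul (hk : 3 ≤ k)
    (hR : 3 ∣ k → ∀ r ∈ R, r.norm = k → FreeGroup.IsCyclicallyReduced r.toWord)
    (f : Vertex n k → Vertex n k → ℝ) :
    ∑ u, ∑ v, ((graph n k R).mult u v : ℝ) * f u v =
      ∑ r ∈ (R.filter fun r => r.norm = k).attach,
        (f (pieceX r.1 (Finset.mem_filter.1 r.2).2) (pieceZ r.1 (Finset.mem_filter.1 r.2).2).inv +
          f (pieceZ r.1 (Finset.mem_filter.1 r.2).2).inv (pieceX r.1 (Finset.mem_filter.1 r.2).2) +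
        (f (pieceY r.1 (Finset.mem_filter.1 r.2).2) (pieceX r.1 (Finset.mem_filter.1 r.2).2).inv +
          f (pieceX r.1 (Finset.mem_filter.1 r.2).2).inv (pieceY r.1 (Finset.mem_filter.1 r.2).2)) +
        (f (pieceZ r.1 (Finset.mem_filter.1 r.2).2) (pieceY r.1 (Finset.mem_filter.1 r.2).2).inv +
          f (pieceY r.1 (Finset.mem_filter.1 r.2).2).inv
            (pieceZ r.1 (Finset.mem_filter.1 r.2).2))) := by
  simp only [EdgeMultigraph.mult, graph, Multiset.count_sum', Nat.cast_sum, Finset.sum_mul]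
  rw [Finset.sum_comm_cycle]
  refine Finset.sum_congr rfl fun r _ => ?_
  have hr := (Finset.mem_filter.1 r.2).2
  have hrR := (Finset.mem_filter.1 r.2).1
  have h1 : pieceX r.1 hr ≠ (pieceZ r.1 hr).inv := fun h =>
    pieceZ_mul_pieceX_ne_one hk r.1 hr (fun h3 => hR h3 _ hrR hr)
      (by rw [h]; exact mul_inv_cancel _)
  have h2 : pieceY r.1 hr ≠ (pieceX r.1 hr).inv := fun h =>
    pieceX_mul_pieceY_ne_one hk r.1 hr (by rw [h]; exact mul_inv_cancel _)
  have h3 : pieceZ r.1 hr ≠ (pieceY r.1 hr).inv := fun h =>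
    pieceY_mul_pieceZ_ne_one hk r.1 hr (by rw [h]; exact mul_inv_cancel _)
  rw [← sum_ite_mk_eq h1, ← sum_ite_mk_eq h2, ← sum_ite_mk_eq h3]
  simp only [← Finset.sum_add_distrib, ← add_mul]
  refine Finset.sum_congr rfl fun u _ => Finset.sum_congr rfl fun v _ => ?_
  congr 1
  simp only [relatorEdges, Multiset.insert_eq_cons, Multiset.count_cons,
    Multiset.count_singleton]
  push_cast
  ring

theorem sum_degree_mul (f : Vertex n k → ℝ) :
    ∑ u, ((graph n k R).degree u : ℝ) * f u =
      ∑ u, ∑ v, ((graph n k R).mult u v : ℝ) * f u := by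
  simp only [EdgeMultigraph.degree, Nat.cast_sum, Finset.sum_mul]

/-- The six endpoints of the edges of a relator are its three pieces and their inverses, a family
stable under inversion. This symmetry is what makes the group Laplacian self-adjoint. -/
theorem degree_inv (hk : 3 ≤ k)
    (hR : 3 ∣ k → ∀ r ∈ R, r.norm = k → FreeGroup.IsCyclicallyReduced r.toWord)
    (v : Vertex n k) : (graph n k R).degree v.inv = (graph n k R).degree v := by
  have key : ∀ f : Vertex n k → ℝ, ∑ u, ((graph n k R).degree u : ℝ) * f u =
      ∑ u, ((graph n k R).degree u : ℝ) * f u.inv := by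
    intro f
    rw [sum_degree_mul, sum_degree_mul, sum_mult_mul R hk hR (fun u _ => f u),
      sum_mult_mul R hk hR (fun u _ => f u.inv)]
    refine Finset.sum_congr rfl fun r _ => ?_
    simp only [Vertex.inv_involutive _]
    ring
  -- The indicator of `v` as test function isolates the two degrees.
  have h := key fun u => if u = v then 1 else 0
  have h1 : ∀ u : Vertex n k, u.inv = v ↔ u = v.inv := fun u =>
    ⟨fun h => by rw [← h, Vertex.inv_involutive], fun h => by rw [h, Vertex.inv_involutive]⟩
  simp only [h1, mul_ite, mul_one, mul_zero, Finset.sum_ite_eq', Finset.mem_univ, if_true] at h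
  exact_mod_cast h.symm

/-! ### Representations that kill the relators. -/

variable {H : Type*} [NormedAddCommGroup H] [InnerProductSpace ℂ H]
  (ρ : FreeGroup (Fin n) →* (H ≃ₗᵢ[ℂ] H))

/-- Each side receives, from every relator, twice the sum of the squared displacements of `x` by the
three pieces: on the left every edge yields the displacement by the piece it omits, on the right the
endpoints are the pieces and their inverses. -/
theorem sum_mult_mul_norm_sub_sq_eq (hk : 3 ≤ k)
    (hR : 3 ∣ k → ∀ r ∈ R, r.norm = k → FreeGroup.IsCyclicallyReduced r.toWord)
    (hρ : ∀ r ∈ R, ρ r = 1) (x : H) :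
    ∑ u, ∑ v, ((graph n k R).mult u v : ℝ) * ‖(ρ u.word x - x) - (ρ v.word x - x)‖ ^ 2 =
      ∑ u, ((graph n k R).degree u : ℝ) * ‖ρ u.word x - x‖ ^ 2 := by
  rw [sum_degree_mul, sum_mult_mul R hk hR fun u v => ‖(ρ u.word x - x) - (ρ v.word x - x)‖ ^ 2,
    sum_mult_mul R hk hR fun u _ => ‖ρ u.word x - x‖ ^ 2]
  refine Finset.sum_congr rfl fun r _ => ?_
  have hr := (Finset.mem_filter.1 r.2).2
  have h1 : ρ (pieceX r.1 hr).word * ρ (pieceY r.1 hr).word * ρ (pieceZ r.1 hr).word = 1 := by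
    have h : (pieceX r.1 hr).word * (pieceY r.1 hr).word * (pieceZ r.1 hr).word = r.1 :=
      pieceX_mul_pieceY_mul_pieceZ r.1 hr
    rw [← map_mul, ← map_mul, h, hρ _ (Finset.mem_filter.1 r.2).1]
  have hinv : ∀ v : Vertex n k, v.inv.word = v.word⁻¹ := fun _ => rfl
  have hedge : ∀ a b c : FreeGroup (Fin n), ρ a * ρ b * ρ c = 1 →
      ‖ρ a x - ρ c⁻¹ x‖ = ‖ρ b x - x‖ := by
    intro a b c h
    have h2 : ρ (c * a) = ρ b⁻¹ := by
      rw [map_mul, map_inv, eq_inv_iff_mul_eq_one]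
      have h3 : ρ a * ρ b = (ρ c)⁻¹ := eq_inv_of_mul_eq_one_left h
      rw [mul_assoc, h3, mul_inv_cancel]
    rw [norm_unitary_apply_sub_unitary_apply, inv_inv, h2, norm_unitary_inv_apply_sub]
  -- Cyclic rotations of the relation reduce the other two edges to `hedge`.
  have hrot : ∀ a b c : H ≃ₗᵢ[ℂ] H, a * b * c = 1 → b * c * a = 1 := by
    intro a b c h
    rw [mul_assoc] at h
    rw [eq_inv_of_mul_eq_one_right h, inv_mul_cancel]
  have h2 := hrot _ _ _ h1
  have h3 := hrot _ _ _ h2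
  simp only [sub_sub_sub_cancel_right, hinv, norm_unitary_inv_apply_sub]
  rw [norm_sub_rev (ρ (pieceZ r.1 hr).word⁻¹ x), norm_sub_rev (ρ (pieceX r.1 hr).word⁻¹ x),
    norm_sub_rev (ρ (pieceY r.1 hr).word⁻¹ x), hedge _ _ _ h1, hedge _ _ _ h2, hedge _ _ _ h3]
  ring

/-- The spectral condition bounds the group Laplacian away from zero off its kernel. -/
theorem exists_mul_inner_groupLaplacian_le (hk : 3 ≤ k)
    (hR : 3 ∣ k → ∀ r ∈ R, r.norm = k → FreeGroup.IsCyclicallyReduced r.toWord)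
    (hdeg : ∀ v : Vertex n k, 0 < (graph n k R).degree v)
    (hlam : 1 / 2 < (graph n k R).lam 1) (hρ : ∀ r ∈ R, ρ r = 1) :
    ∃ c : ℝ, 0 < c ∧ ∀ x : H,
      c * (inner ℂ (groupLaplacian ρ (graph n k R).degree Vertex.word x) x).re ≤
        ‖groupLaplacian ρ (graph n k R).degree Vertex.word x‖ ^ 2 := by
  have hlam0 : 0 < (graph n k R).lam 1 := by linarith
  obtain ⟨i₀, -⟩ := (graph n k R).exists_forall_lam_one_le hlam0
  have hvol : (0 : ℝ) < ∑ u, ((graph n k R).degree u : ℝ) :=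
    Finset.sum_pos (fun u _ => by exact_mod_cast hdeg u) ⟨i₀, Finset.mem_univ _⟩
  -- Solves `(λ₁ - 1/2) S ≤ λ₁ ‖D x‖ ^ 2 / vol` for `‖D x‖ ^ 2`, with `S = 2 Re ⟪D x, x⟫`.
  refine ⟨(2 * (graph n k R).lam 1 - 1) * (∑ u, ((graph n k R).degree u : ℝ)) /
    (graph n k R).lam 1, div_pos (mul_pos (by linarith) hvol) hlam0, fun x => ?_⟩
  let := InnerProductSpace.rclikeToReal ℂ H
  have h := (graph n k R).lam_one_mul_le hdeg hlam0 fun u => ρ u.word x - x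
  rw [sum_mult_mul_norm_sub_sq_eq R ρ hk hR hρ] at h
  have h1 : ‖∑ u, (graph n k R).degree u • (ρ u.word x - x)‖ =
      ‖groupLaplacian ρ (graph n k R).degree Vertex.word x‖ := by
    rw [← norm_neg, ← Finset.sum_neg_distrib]
    refine congrArg norm ?_
    refine Eq.trans ?_ (groupLaplacian_apply ρ _ _ _).symm
    refine Finset.sum_congr rfl fun u _ => ?_
    rw [← smul_neg, neg_sub]
  rw [h1] at h
  have h2 := re_inner_groupLaplacian ρ (graph n k R).degree Vertex.word x
  rw [h2]
  set S := ∑ u, ((graph n k R).degree u : ℝ) * ‖ρ u.word x - x‖ ^ 2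
  set vol := ∑ u, ((graph n k R).degree u : ℝ)
  set l := (graph n k R).lam 1
  set N := ‖groupLaplacian ρ (graph n k R).degree Vertex.word x‖ ^ 2
  have h3 : (l - 1 / 2) * S ≤ l * N / vol := by
    have : l * (N / vol) = l * N / vol := (mul_div_assoc _ _ _).symm
    linarith
  rw [le_div_iff₀ hvol] at h3
  rw [div_mul_eq_mul_div, div_le_iff₀ hlam0]
  linarith

/-! ### Finite index of the subgroup generated by the vertices, and invariant vectors. -/

/-- Every element of the free group is a product of a short element and of elements of length
`lenXY k`. -/
theorem exists_norm_lt_inv_mul_mem (hk : 3 ≤ k) (g : FreeGroup (Fin n)) :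
    ∃ t : FreeGroup (Fin n), t.norm < lenXY k ∧
      t⁻¹ * g ∈ Subgroup.closure (Set.range (Vertex.word : Vertex n k → FreeGroup (Fin n))) := by
  have hp := lenXY_pos hk
  induction hm : g.norm using Nat.strong_induction_on generalizing g with
  | _ m ih =>
    by_cases hlt : g.norm < lenXY k
    · exact ⟨g, hlt, by rw [inv_mul_cancel]; exact one_mem _⟩
    -- The last `lenXY k` letters form a vertex. Removing them on the right keeps the left coset and
    -- shortens the word.
    · set j := g.norm - lenXY k with hj
      have hlen : g.toWord.length = g.norm := rfl
      have h1 := norm_mk_infix g (List.take_prefix j _).isInfix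
      have h2 := norm_mk_infix g (List.drop_suffix j _).isInfix
      rw [List.length_take] at h1
      rw [List.length_drop] at h2
      have hg : FreeGroup.mk (g.toWord.take j) * FreeGroup.mk (g.toWord.drop j) = g := by
        rw [FreeGroup.mul_mk, List.take_append_drop, FreeGroup.mk_toWord]
      have h3 : (FreeGroup.mk (g.toWord.drop j)).norm = lenXY k := by omega
      obtain ⟨t, ht, hmem⟩ := ih _ (by omega) (FreeGroup.mk (g.toWord.take j)) rfl
      refine ⟨t, ht, ?_⟩
      rw [← hg, ← mul_assoc]
      exact mul_mem hmem (Subgroup.subset_closure ⟨⟨FreeGroup.mk (g.toWord.drop j), Or.inl h3⟩, rfl⟩)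

theorem finite_norm_lt (n m : ℕ) : {t : FreeGroup (Fin n) | t.norm < m}.Finite := by
  refine Set.Finite.of_finite_image ((List.finite_length_lt (Fin n × Bool) m).subset ?_)
    FreeGroup.toWord_injective.injOn
  rintro _ ⟨t, ht, rfl⟩
  exact ht

theorem finiteIndex_closure_vertices (hk : 3 ≤ k) :
    (Subgroup.closure
      (Set.range (Vertex.word : Vertex n k → FreeGroup (Fin n)))).FiniteIndex := by
  set Λ := Subgroup.closure (Set.range (Vertex.word : Vertex n k → FreeGroup (Fin n)))
  have := (finite_norm_lt n (lenXY k)).to_subtype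
  have : Finite (FreeGroup (Fin n) ⧸ Λ) := by
    refine Finite.of_surjective
      (fun t : {t : FreeGroup (Fin n) | t.norm < lenXY k} => (t.1 : FreeGroup (Fin n) ⧸ Λ)) ?_
    intro q
    induction q using QuotientGroup.induction_on with
    | H g =>
      obtain ⟨t, ht, h⟩ := exists_norm_lt_inv_mul_mem hk g
      exact ⟨⟨t, ht⟩, QuotientGroup.eq.2 h⟩
  exact Subgroup.finiteIndex_of_finite_quotient

/-- Unitary representations with uniformly almost invariant vectors for all finite sets have
invariant vectors. -/
theorem exists_invariant [CompleteSpace H] (hk : 3 ≤ k)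
    (hR : 3 ∣ k → ∀ r ∈ R, r.norm = k → FreeGroup.IsCyclicallyReduced r.toWord)
    (hdeg : ∀ v : Vertex n k, 0 < (graph n k R).degree v)
    (hlam : 1 / 2 < (graph n k R).lam 1) (hρ : ∀ r ∈ R, ρ r = 1)
    (hai : ∀ T : Set (FreeGroup (Fin n)), T.Finite → ∀ ε : ℝ, 0 < ε →
      ∃ u : H, u ≠ 0 ∧ ∀ t ∈ T, ‖ρ t u - u‖ ≤ ε * ‖u‖) :
    ∃ u : H, u ≠ 0 ∧ ∀ g, ρ g u = u := by
  obtain ⟨c, hc, hgap⟩ := exists_mul_inner_groupLaplacian_le R ρ hk hR hdeg hlam hρ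
  set vol := ∑ u, ((graph n k R).degree u : ℝ) with hvol
  have hvol0 : 0 ≤ vol := Finset.sum_nonneg fun u _ => Nat.cast_nonneg _
  -- The bound `c / 16` places the kernel vector within `‖u‖ / 4` of `u`; `ε ≤ 1 / 4` allows another
  -- `‖u‖ / 4` for moving `u` by a coset representative, for a total of `‖u‖ / 2`.
  obtain ⟨ε, hε, hε4, hεc⟩ : ∃ ε : ℝ, 0 < ε ∧ ε ≤ 1 / 4 ∧ vol * ε ^ 2 ≤ c / 16 := by
    have h1 : Filter.Tendsto (fun ε : ℝ => vol * ε ^ 2) (nhdsWithin 0 (Set.Ioi 0)) (nhds 0) := by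
      have : Filter.Tendsto (fun ε : ℝ => vol * ε ^ 2) (nhds 0) (nhds (vol * 0 ^ 2)) :=
        Continuous.tendsto (by fun_prop) 0
      rw [zero_pow two_ne_zero, mul_zero] at this
      exact this.mono_left nhdsWithin_le_nhds
    have h2 := h1.eventually (ge_mem_nhds (show (0 : ℝ) < c / 16 by positivity))
    have h3 : ∀ᶠ ε : ℝ in nhdsWithin 0 (Set.Ioi 0), ε ∈ Set.Ioc (0 : ℝ) (1 / 4) :=
      Ioc_mem_nhdsGT (by norm_num)
    obtain ⟨ε, h4, h5⟩ := (h3.and h2).exists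
    exact ⟨ε, h4.1, h4.2, h5⟩
  -- The vertices control the Laplacian at `u`; the short words represent all cosets.
  obtain ⟨u, hu, hT⟩ := hai
    (Set.range (Vertex.word : Vertex n k → FreeGroup (Fin n)) ∪ {t | t.norm < lenXY k})
    ((Set.finite_range _).union (finite_norm_lt _ _)) ε hε
  have hsymm := groupLaplacian_symm ρ (graph n k R).degree
    (Vertex.word : Vertex n k → FreeGroup (Fin n)) Vertex.inv_involutive (fun _ => rfl)
    (degree_inv R hk hR)
  have hpos : ∀ x : H, 0 ≤ (inner ℂ (groupLaplacian ρ (graph n k R).degree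
      (Vertex.word : Vertex n k → FreeGroup (Fin n)) x) x).re := fun x => by
    rw [re_inner_groupLaplacian]; positivity
  obtain ⟨v, hv0, hv⟩ := (groupLaplacian ρ (graph n k R).degree
    Vertex.word).exists_apply_eq_zero_mul_norm_sub_sq_le hsymm hpos hc hgap u
  have huv : ‖u - v‖ ≤ 1 / 4 * ‖u‖ := by
    have h1 : ∑ w : Vertex n k, ((graph n k R).degree w : ℝ) * ‖ρ w.word u - u‖ ^ 2 ≤
        vol * (ε * ‖u‖) ^ 2 := by
      rw [hvol, Finset.sum_mul]
      refine Finset.sum_le_sum fun w _ => ?_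
      have := hT w.word (Or.inl ⟨w, rfl⟩)
      gcongr
    rw [re_inner_groupLaplacian] at hv
    have h2 : vol * (ε * ‖u‖) ^ 2 ≤ c / 16 * ‖u‖ ^ 2 := by
      rw [mul_pow, ← mul_assoc]
      gcongr
    have h3 : 0 ≤ c / 16 * ‖u‖ ^ 2 := by positivity
    have h4 : c * ‖u - v‖ ^ 2 ≤ c * (1 / 4 * ‖u‖) ^ 2 := by
      rw [mul_pow]
      linarith
    exact le_of_sq_le_sq (le_of_mul_le_mul_left h4 hc) (by positivity)
  have hinv : ∀ g ∈ Subgroup.closure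
      (Set.range (Vertex.word : Vertex n k → FreeGroup (Fin n))), ρ g v = v := by
    intro g hg
    induction hg using Subgroup.closure_induction with
    | mem x hx =>
      obtain ⟨w, rfl⟩ := hx
      exact unitary_apply_eq_of_groupLaplacian_eq_zero ρ _ _ hdeg hv0 w
    | one => exact unitary_one_apply ρ v
    | mul x y _ _ hx hy => rw [unitary_mul_apply, hy, hx]
    | inv x _ hx =>
      nth_rewrite 1 [← hx]
      exact unitary_inv_apply_self ρ x v
  have := finiteIndex_closure_vertices (n := n) hk
  refine exists_invariant_of_finiteIndex ρ _ hu hinv fun g => ?_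
  obtain ⟨t, ht, hg⟩ := exists_norm_lt_inv_mul_mem hk g
  have h1 : ρ g v = ρ t v := by
    have h2 : g = t * (t⁻¹ * g) := by rw [mul_inv_cancel_left]
    rw [h2, unitary_mul_apply, hinv _ hg]
  have h3 : ρ t v - u = (ρ t u - u) - ρ t (u - v) := by rw [map_sub]; abel
  rw [h1, h3]
  refine (norm_sub_le _ _).trans ?_
  rw [(ρ t).norm_map]
  have h4 := hT t (Or.inr ht)
  have h5 : ε * ‖u‖ ≤ 1 / 4 * ‖u‖ := by gcongr
  linarith

end SplitGraph

/-! ### Passage to the presented group. -/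

/-- Almost invariance is given on `S` but needed on vertices and short words. Each `t` is a product
of generators and inverses, so its displacement is at most a constant times that of `S`, and
finiteness of `T` makes the constant uniform. -/
theorem HasAlmostInvariantVectors.exists_of_finite {Γ : Type*} [Group Γ] {H : Type*}
    [NormedAddCommGroup H] [InnerProductSpace ℂ H] {S : Finset Γ} {π : Γ →* (H ≃ₗᵢ[ℂ] H)}
    (h : HasAlmostInvariantVectors S π) (hS : Subgroup.closure (S : Set Γ) = ⊤) {T : Set Γ}
    (hT : T.Finite) {ε : ℝ} (hε : 0 < ε) :
    ∃ u : H, u ≠ 0 ∧ ∀ t ∈ T, ‖π t u - u‖ ≤ ε * ‖u‖ := by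
  have hC : ∀ t : Γ, ∃ C : ℝ, 0 ≤ C ∧ ∀ (u : H) (ε : ℝ),
      (∀ s ∈ (S : Set Γ), ‖π s u - u‖ ≤ ε) → 0 ≤ ε → ‖π t u - u‖ ≤ C * ε := fun t =>
    exists_norm_unitary_apply_sub_le π (S : Set Γ) (by rw [hS]; trivial)
  choose C hC0 hC using hC
  -- Dominates every `C t` with `t ∈ T`; the `1` keeps it positive when `T` is empty or all
  -- constants vanish.
  set M := 1 + ∑ t ∈ hT.toFinset, C t with hM
  have hM0 : 0 < M := add_pos_of_pos_of_nonneg one_pos (Finset.sum_nonneg fun t _ => hC0 t)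
  obtain ⟨u, hu, hus⟩ := h (ε / M) (div_pos hε hM0)
  refine ⟨u, hu, fun t ht => ?_⟩
  have h0 : 0 ≤ ε / M * ‖u‖ := by positivity
  refine (hC t u (ε / M * ‖u‖) (fun s hs => (hus s hs).le) h0).trans ?_
  have h1 : C t ≤ M :=
    (Finset.single_le_sum (fun t _ => hC0 t) (hT.mem_toFinset.2 ht)).trans (by linarith)
  calc C t * (ε / M * ‖u‖) ≤ M * (ε / M * ‖u‖) := by gcongr
    _ = ε * ‖u‖ := by field_simp

theorem mainTheorem5 (n k : ℕ) (hk : 3 ≤ k) (R : Finset (FreeGroup (Fin n)))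
    (hR : 3 ∣ k → ∀ r ∈ R, r.norm = k → FreeGroup.IsCyclicallyReduced r.toWord)
    (hdeg : ∀ v : SplitGraph.Vertex n k, 0 < (SplitGraph.graph n k R).degree v)
    (hlam : 1 / 2 < (SplitGraph.graph n k R).lam 1) :
    HasPropertyT.{u, 0} (PresentedGroup (R : Set (FreeGroup (Fin n)))) := by
  refine ⟨Group.fg_of_surjective (PresentedGroup.mk_surjective (R : Set (FreeGroup (Fin n)))), ?_⟩
  intro S hS H _ _ _ π hπ
  obtain ⟨u, hu, hinv⟩ := SplitGraph.exists_invariant R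
    (π.comp (PresentedGroup.mk (R : Set (FreeGroup (Fin n))))) hk hR hdeg hlam
    (fun r hr => by
      rw [MonoidHom.comp_apply, PresentedGroup.one_of_mem (by exact_mod_cast hr), map_one])
    (fun T hT ε hε => by
      obtain ⟨u, hu, h⟩ := hπ.exists_of_finite hS
        (hT.image (PresentedGroup.mk (R : Set (FreeGroup (Fin n))))) hε
      exact ⟨u, hu, fun t ht => h _ ⟨t, ht, rfl⟩⟩)
  refine ⟨u, hu, fun g => ?_⟩
  obtain ⟨g, rfl⟩ := PresentedGroup.mk_surjective _ g
  exact hinv g
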